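/- Let $n,d\geqslant 1$ and let $|\psi\rangle_{A_1\cdots A_n}=\sqrt p\,|W_n^d\rangle+\sqrt{1-p}\,|0\cdots0\rangle$, $0\leqslant p\leqslant1$, be an $n$-qudit GWV state, where $|W_n^d\rangle=\sum_{s=1}^n\sum_{i=1}^{d-1}a_{si}\,|0\cdots0\,i\,0\cdots0\rangle$ (with $i$ in position $s$) and $\sum_{s,i}|a_{si}|^2=1$. Let $P,P_0,\dots,P_{r-1}$ be pairwise disjoint non-empty sets of the qudits $A_1,\dots,A_n$ (so they form a partition of some subset of the qudits, possibly of all of them). Let $\rho_{PP_j}$ be the reduced density matrix of $|\psi\rangle\langle\psi|$ on $P\cup P_j$, viewed as a bipartite state of $P$ and $P_j$, and $\rho_{P|P_0\cdots P_{r-1}}$ the one on $P\cup P_0\cup\dots\cup P_{r-1}$, viewed as a bipartite state of $P$ and $P_0\cup\dots\cup P_{r-1}$. For a bipartite pure state with first reduced density matrix $\rho_A$ let $T_q(|\phi\rangle_{AB})=\frac{1-\mathrm{tr}\,\rho_A^q}{q-1}$ for $q>0$, $q\ne1$, and let $T_1(|\phi\rangle_{AB})=\lim_{q\to1}T_q(|\phi\rangle_{AB})=-\mathrm{tr}\,\rho_A\ln\rho_A$.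 For a bipartite mixed state $\rho$ let $T_q(\rho)=\min\sum_i p_iT_q(|\phi_i\rangle)$ over all pure state decompositions $\rho=\sum_ip_i|\phi_i\rangle\langle\phi_i|$. Let $q\in\big[\frac{5-\sqrt{13}}2,\frac{5+\sqrt{13}}2\big]$, $\beta\in[2,\infty)$, $0<k\leqslant1$ and $\mathcal K_\beta=\frac{(1+k)^{\beta/2}-1}{k^{\beta/2}}$. If $$k\,T_q^2(\rho_{PP_l})\geqslant\sum_{j=l+1}^{r-1}T_q^2(\rho_{PP_j})\qquad\text{for } l=0,1,\dots,r-2,$$ then $$T_q^\beta(\rho_{P|P_0\cdots P_{r-1}})\;\geqslant\;\sum_{j=0}^{r-1}\mathcal K_\beta^{\,j}\,T_q^\beta(\rho_{PP_j})\;\geqslant\;\sum_{j=0}^{r-1}\mathcal K_\beta^{\,\omega_H(j)}\,T_q^\beta(\rho_{PP_j}),$$ where $\omega_H(j)$ is the number of ones in the binary expansion of $j$. -/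

import Mathlib

noncomputable section

/-- A pure state of `n` qudits, each with computational basis `|0⟩, …, |d-1⟩`, given by its
amplitudes in the product basis. -/
abbrev QuditVec (n d : ℕ) : Type := (Fin n → Fin d) → ℂ

/-- The basis vector `|x₁ x₂ … xₙ⟩`. -/
def ket {n d : ℕ} (x : Fin n → Fin d) : QuditVec n d := Pi.single x 1

/-- The (generalized) `W`-class vector `∑ₛ ∑_{i ≠ 0} a s i |0 … 0 i 0 … 0⟩`, with the excitation
`i` on qudit `s`. Only the coefficients `a s i` with `i ≠ 0` are used. -/
def wVec {n d : ℕ} [NeZero d] (a : Fin n → Fin d → ℂ) : QuditVec n d :=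
  ∑ s, ∑ i ∈ Finset.univ.filter (fun i : Fin d => i ≠ 0), a s i • ket (Pi.single s i)

/-- `ψ` is a superposition `√p |W⟩ + √(1-p) |0…0⟩` of a normalized generalized `W`-class state
and the vacuum. -/
def IsGWV {n d : ℕ} [NeZero d] (ψ : QuditVec n d) : Prop :=
  ∃ (p : ℝ) (a : Fin n → Fin d → ℂ), 0 ≤ p ∧ p ≤ 1 ∧
    ∑ s, ∑ i ∈ Finset.univ.filter (fun i : Fin d => i ≠ 0), ‖a s i‖ ^ 2 = 1 ∧
    ψ = (Real.sqrt p : ℂ) • wVec a + (Real.sqrt (1 - p) : ℂ) • ket 0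

/-- Configurations (basis labels) of the qudits in `S`. -/
abbrev Config {n : ℕ} (d : ℕ) (S : Finset (Fin n)) : Type := {i // i ∈ S} → Fin d

/-- The configuration of all qudits which is `x` on `S` and `z` off `S`. -/
def glue {n d : ℕ} (S : Finset (Fin n)) (x : Config d S) (z : {i // i ∉ S} → Fin d) :
    Fin n → Fin d :=
  fun i => if h : i ∈ S then x ⟨i, h⟩ else z ⟨i, h⟩

/-- The reduced density matrix of `|ψ⟩⟨ψ|` on the qudits in `S`: the partial trace over all the
other qudits. -/
def reducedState {n d : ℕ} (ψ : QuditVec n d) (S : Finset (Fin n)) :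
    Matrix (Config d S) (Config d S) ℂ :=
  Matrix.of fun x y => ∑ z : {i // i ∉ S} → Fin d, ψ (glue S x z) * star (ψ (glue S y z))

/-- For disjoint `A` and `B`, the identification of a pair of configurations of `A` and `B` with a
configuration of `A ∪ B`. -/
def join {n d : ℕ} (A B : Finset (Fin n)) (x : Config d A × Config d B) : Config d (A ∪ B) :=
  fun i => if h : (i : Fin n) ∈ A then x.1 ⟨i, h⟩
    else x.2 ⟨i, (Finset.mem_union.mp i.2).resolve_left h⟩

/-- The reduced density matrix `ρ_{A|B}` on the qudits in `A ∪ B`, viewed as a state of the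
bipartite system with parties `A` and `B` (used for disjoint `A` and `B`). -/
def bipartiteReduced {n d : ℕ} (ψ : QuditVec n d) (A B : Finset (Fin n)) :
    Matrix (Config d A × Config d B) (Config d A × Config d B) ℂ :=
  (reducedState ψ (A ∪ B)).submatrix (join A B) (join A B)

/-- The amplitudes of a bipartite vector as a matrix. -/
def ampMatrix {α β : Type} (φ : α × β → ℂ) : Matrix α β ℂ := Matrix.of fun a b => φ (a, b)

/-- The first reduced density matrix of a bipartite vector: the partial trace of `|φ⟩⟨φ|` over the
second party, with entries `∑ b, φ (a, b) * conj (φ (a', b))`. -/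
def reducedLeft {α β : Type} [Fintype β] (φ : α × β → ℂ) : Matrix α α ℂ :=
  ampMatrix φ * (ampMatrix φ).conjTranspose

theorem reducedLeft_isHermitian {α β : Type} [Fintype β] (φ : α × β → ℂ) :
    (reducedLeft φ).IsHermitian :=
  Matrix.isHermitian_mul_conjTranspose_self _

/-- The Tsallis-`q` entropy `(1 - tr ρ^q) / (q - 1)`, through the eigenvalues of `ρ`; at `q = 1` it
is the limit `q → 1`, the von Neumann entropy `-tr (ρ log ρ)`. -/
def tsallisEntropy {α : Type} [Fintype α] [DecidableEq α] (q : ℝ) (ρ : Matrix α α ℂ)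
    (hρ : ρ.IsHermitian) : ℝ :=
  if q = 1 then ∑ i, Real.negMulLog (hρ.eigenvalues i)
  else (1 - ∑ i, hρ.eigenvalues i ^ q) / (q - 1)

/-- Tsallis-`q` entanglement of a bipartite pure state. -/
def pureTqE {α β : Type} [Fintype α] [DecidableEq α] [Fintype β] (q : ℝ) (φ : α × β → ℂ) : ℝ :=
  tsallisEntropy q (reducedLeft φ) (reducedLeft_isHermitian φ)

/-- `{(w i, φ i)}` is a (finite) pure state decomposition of `ρ`. -/
def IsPureDecomposition {κ : Type} [Fintype κ] (ρ : Matrix κ κ ℂ) {N : ℕ}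
    (w : Fin N → ℝ) (φ : Fin N → κ → ℂ) : Prop :=
  (∀ i, 0 ≤ w i) ∧ ∑ i, w i = 1 ∧ (∀ i, ∑ x, ‖φ i x‖ ^ 2 = 1) ∧
    ρ = ∑ i, (w i : ℂ) • Matrix.vecMulVec (φ i) (star (φ i))

/-- Tsallis-`q` entanglement of a bipartite mixed state: the convex roof of the pure state
quantity. -/
def TqE {α β : Type} [Fintype α] [DecidableEq α] [Fintype β] (q : ℝ)
    (ρ : Matrix (α × β) (α × β) ℂ) : ℝ :=
  sInf {t : ℝ | ∃ (N : ℕ) (w : Fin N → ℝ) (φ : Fin N → α × β → ℂ),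
    IsPureDecomposition ρ w φ ∧ t = ∑ i, w i * pureTqE q (φ i)}

/-- The factor `𝒦_β = ((1 + k)^(β/2) - 1) / k^(β/2)`. -/
def Kfactor (k β : ℝ) : ℝ := ((1 + k) ^ (β / 2) - 1) / k ^ (β / 2)

/-- The Hamming weight of `j`: the number of ones in its binary expansion. -/
def hammingWeight (j : ℕ) : ℕ := (Nat.digits 2 j).count 1

end

/-!
For a state `ψ` with at most one excitation, the reduced state on `A ∪ B` is `|ξ⟩⟨ξ| + μ |0⟩⟨0|`,
where `ξ` has at most one excitation (`IsGWV.reducedState_apply`). Every vector in a pure state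
decomposition of it is, apart from its vacuum amplitude, a multiple of `ξ`, and the squared moduli of
the multiples average to `1` (`IsPureDecomposition.exists_smul`). The first reduced density matrix of
a normalized vector of this kind has rank at most two and determinant `a * b`, with `a`, `b` the
weights of the excitations in `A` and in `B` (`NoDoubleExcitation.pureTqE_eq`), so its entanglement
is a function `concurrenceEntropy q` of its concurrence `2 √(a b)`. Hence the concurrence averages to
that of `ξ` in every decomposition. If `concurrenceEntropy q` is convex, the convex roof is its value
at this average, attained by the two vectors `ξ ± i√μ |0⟩` (`TqE_eq_concurrenceEntropy`).

Convexity (`convexOn_concurrenceEntropy`) is where the range of `q` enters. The summand of the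
Tsallis entropy has second derivative `-q y ^ (q - 2)` for every `q`, including `q = 1`. In terms of
`s = √(1 - x²)` the sign of the second derivative of `concurrenceEntropy q` follows, after one more
differentiation, from
`(1 + s) ^ a * (a - b * s) ≤ (1 - s) ^ a * (a + b * s)` with `a = |q - 2|` and `b = q + 1`, valid
when `a² ≤ b`, that is, when `q² - 5 q + 3 ≤ 0`.

The squared concurrence of `P` with `B` is `4` times the product of the weights of `P` and `B`, hence
additive in `B`. As `f x / x` is monotone for a convex `f` with `f 0 = 0`, the squared entanglement
is superadditive (`IsGWV.sum_sq_TqE_le`). The weights `Kfactor k β ^ j` come from iterating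
`rpow_add_le_rpow_add_of_le_mul`, and the comparison with the Hamming weights holds because
`Kfactor k β ≥ 1`.
-/

/-! ### The binary Tsallis entropy as a function of the concurrence -/

/-- The key one-variable inequality, for `a² ≤ b`; with `a = |q - 2|` and `b = q + 1` the hypothesis
`a² ≤ b` says exactly that `q` lies between `(5 - √13)/2` and `(5 + √13)/2`. -/
theorem one_add_rpow_mul_le {a b s : ℝ} (ha : 0 ≤ a) (hb : 1 ≤ b) (hab : a ^ 2 ≤ b)
    (hs0 : 0 ≤ s) (hs1 : s < 1) :
    (1 + s) ^ a * (a - b * s) ≤ (1 - s) ^ a * (a + b * s) := by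
  rcases le_or_gt (a - b * s) 0 with h | h
  · have h1 : (1 + s) ^ a * (a - b * s) ≤ 0 :=
      mul_nonpos_of_nonneg_of_nonpos (by positivity) h
    have h2 : 0 ≤ (1 - s) ^ a * (a + b * s) :=
      mul_nonneg (Real.rpow_nonneg (by linarith) _) (by positivity)
    linarith
  -- Both sides are positive on `[0, s]`; the difference of their logarithms is monotone there.
  have hpos : ∀ t ∈ Set.Icc 0 s, 0 < a - b * t := by
    intro t ht
    nlinarith [ht.2]
  have hmono : MonotoneOn (fun t => a * (Real.log (1 - t) - Real.log (1 + t)) +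
      (Real.log (a + b * t) - Real.log (a - b * t))) (Set.Icc 0 s) := by
    have hd : ∀ t ∈ Set.Icc 0 s, HasDerivAt (fun t => a * (Real.log (1 - t) - Real.log (1 + t)) +
      (Real.log (a + b * t) - Real.log (a - b * t)))
        (a * (-1 / (1 - t) - 1 / (1 + t)) + (b / (a + b * t) - (-b) / (a - b * t))) t := by
      intro t ht
      have h1 := hpos t ht
      have ht0 := ht.1
      have ht1 := ht.2
      have h2 : 0 < a + b * t := by
        have : 0 ≤ b * t := by positivity
        linarith
      refine ((HasDerivAt.sub ?_ ?_).const_mul a).add (HasDerivAt.sub ?_ ?_)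
      · exact ((hasDerivAt_id' t).const_sub 1).log (by simp; linarith)
      · exact ((hasDerivAt_id' t).const_add 1).log (by simp; linarith)
      · have := (((hasDerivAt_id' t).const_mul b).const_add a).log h2.ne'
        simpa using this
      · have := (((hasDerivAt_id' t).const_mul b).const_sub a).log h1.ne'
        simpa using this
    apply monotoneOn_of_deriv_nonneg (convex_Icc 0 s)
    · exact fun t ht => (hd t ht).continuousAt.continuousWithinAt
    · exact fun t ht => (hd t (interior_subset ht)).differentiableAt.differentiableWithinAt
    · intro t ht
      have ht' := interior_subset ht
      rw [(hd t ht').deriv]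
      have h1 := hpos t ht'
      have ht0 := ht'.1
      have ht1 : t < 1 := ht'.2.trans_lt hs1
      have h2 : 0 < a + b * t := by
        have : 0 ≤ b * t := by positivity
        linarith
      have h3 : 0 < 1 - t := by linarith
      have h4 : 0 < 1 + t := by linarith
      have : a * (-1 / (1 - t) - 1 / (1 + t)) + (b / (a + b * t) - (-b) / (a - b * t)) =
          2 * a * ((b - a ^ 2) + b * (b - 1) * t ^ 2) /
            ((1 - t) * (1 + t) * ((a + b * t) * (a - b * t))) := by
        have h1' := h1.ne'
        have h2' := h2.ne'
        have h3' := h3.ne'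
        have h4' := h4.ne'
        rw [div_sub_div _ _ h3' h4', div_sub_div _ _ h2' h1', mul_div_assoc', div_add_div _ _
          (mul_ne_zero h3' h4') (mul_ne_zero h2' h1'), div_eq_div_iff (by positivity)
          (by positivity)]
        ring
      rw [this]
      have h5 : 0 ≤ b - a ^ 2 := by linarith
      have h6 : 0 ≤ b - 1 := by linarith
      positivity
  have h0 := hmono ⟨le_rfl, hs0⟩ ⟨hs0, le_rfl⟩ hs0
  simp only [sub_zero, add_zero, mul_zero, Real.log_one, sub_self] at h0
  have h2 : 0 < a + b * s := by
    have : 0 ≤ b * s := by positivity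
    linarith
  have h3 : 0 < 1 - s := by linarith
  have h4 : 0 < 1 + s := by linarith
  rw [← Real.log_le_log_iff (by positivity) (by positivity),
    Real.log_mul (by positivity) h.ne', Real.log_mul (by positivity) h2.ne',
    Real.log_rpow h4, Real.log_rpow h3]
  linarith

theorem rpow_combination_nonneg {q s : ℝ} (hq0 : 0 < q) (hq : (q - 2) ^ 2 ≤ q + 1)
    (hs0 : 0 ≤ s) (hs1 : s < 1) :
    0 ≤ (1 + s) ^ (q - 2) * ((q + 1) * s - (q - 2)) +
      (1 - s) ^ (q - 2) * ((q + 1) * s + (q - 2)) := by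
  have h := one_add_rpow_mul_le (abs_nonneg (q - 2)) (by linarith : (1 : ℝ) ≤ q + 1)
    (by rwa [sq_abs]) hs0 hs1
  rcases le_total 0 (q - 2) with h2 | h2
  · rw [abs_of_nonneg h2] at h
    linarith
  · rw [abs_of_nonpos h2, Real.rpow_neg (by linarith), Real.rpow_neg (by linarith)] at h
    have h3 : 0 < (1 - s) ^ (q - 2) := Real.rpow_pos_of_pos (by linarith) _
    have h4 : 0 < (1 + s) ^ (q - 2) := Real.rpow_pos_of_pos (by linarith) _
    rw [inv_mul_eq_div, inv_mul_eq_div, div_le_div_iff₀ h4 h3] at h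
    linarith

/-- The summand of the Tsallis entropy, normalized to vanish at `0` and `1`. -/
noncomputable def tsallisSummand (q y : ℝ) : ℝ :=
  if q = 1 then Real.negMulLog y else (y - y ^ q) / (q - 1)

/-- The derivative of `tsallisSummand q` on the positive reals. -/
noncomputable def tsallisSummandDeriv (q y : ℝ) : ℝ :=
  if q = 1 then -Real.log y - 1 else (1 - q * y ^ (q - 1)) / (q - 1)

theorem hasDerivAt_tsallisSummand (q : ℝ) {y : ℝ} (hy : 0 < y) :
    HasDerivAt (tsallisSummand q) (tsallisSummandDeriv q y) y := by
  by_cases h : q = 1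
  · have h1 : tsallisSummand q = Real.negMulLog := by ext; simp [tsallisSummand, h]
    rw [h1, tsallisSummandDeriv, if_pos h]
    exact Real.hasDerivAt_negMulLog hy.ne'
  · have h1 : tsallisSummand q = fun y => (y - y ^ q) / (q - 1) := by
      ext; simp [tsallisSummand, h]
    rw [h1, tsallisSummandDeriv, if_neg h]
    exact ((hasDerivAt_id' y).sub (Real.hasDerivAt_rpow_const (Or.inl hy.ne'))).div_const _

theorem hasDerivAt_tsallisSummandDeriv (q : ℝ) {y : ℝ} (hy : 0 < y) :
    HasDerivAt (tsallisSummandDeriv q) (-q * y ^ (q - 2)) y := by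
  by_cases h : q = 1
  · have h1 : tsallisSummandDeriv q = fun y => -Real.log y - 1 := by
      ext; simp [tsallisSummandDeriv, h]
    rw [h1]
    refine ((Real.hasDerivAt_log hy.ne').neg.sub_const 1).congr_deriv ?_
    rw [h, show (1 : ℝ) - 2 = -1 by norm_num, Real.rpow_neg_one]
    ring
  · have h1 : tsallisSummandDeriv q = fun y => (1 - q * y ^ (q - 1)) / (q - 1) := by
      ext; simp [tsallisSummandDeriv, h]
    rw [h1]
    have h2 : q - 1 ≠ 0 := sub_ne_zero.mpr h
    have h3 := (((Real.hasDerivAt_rpow_const (p := q - 1) (Or.inl hy.ne')).const_mul q).const_sub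
      1).div_const (q - 1)
    refine h3.congr_deriv ?_
    rw [show q - 1 - 1 = q - 2 by ring]
    field_simp

theorem continuous_tsallisSummand {q : ℝ} (hq : 0 < q) : Continuous (tsallisSummand q) := by
  by_cases h : q = 1
  · have h1 : tsallisSummand q = Real.negMulLog := by ext; simp [tsallisSummand, h]
    rw [h1]
    exact Real.continuous_negMulLog
  · have h1 : tsallisSummand q = fun y => (y - y ^ q) / (q - 1) := by
      ext; simp [tsallisSummand, h]
    rw [h1]
    exact (continuous_id.sub (Real.continuous_rpow_const hq.le)).div_const _

theorem tsallisSummand_zero {q : ℝ} (hq : 0 < q) : tsallisSummand q 0 = 0 := by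
  simp [tsallisSummand, Real.zero_rpow hq.ne']

theorem tsallisSummand_one (q : ℝ) : tsallisSummand q 1 = 0 := by
  simp [tsallisSummand]

theorem tsallisSummand_nonneg {q y : ℝ} (h0 : 0 ≤ y) (h1 : y ≤ 1) (hq : 0 < q) :
    0 ≤ tsallisSummand q y := by
  rw [tsallisSummand]
  split_ifs with h
  · exact Real.negMulLog_nonneg h0 h1
  · rcases lt_or_gt_of_ne h with h | h
    · have := Real.rpow_le_rpow_of_exponent_ge' h0 h1 hq.le h.le
      rw [Real.rpow_one] at this
      exact div_nonneg_of_nonpos (by linarith) (by linarith)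
    · have := Real.rpow_le_rpow_of_exponent_ge' h0 h1 zero_le_one h.le
      rw [Real.rpow_one] at this
      exact div_nonneg (by linarith) (by linarith)

/-- The Tsallis-`q` entropy of the spectrum `(1 ± √(1 - x²)) / 2`, that is, the entanglement of a
pure state of concurrence `x` and Schmidt rank at most two. -/
noncomputable def concurrenceEntropy (q x : ℝ) : ℝ :=
  tsallisSummand q ((1 + Real.sqrt (1 - x ^ 2)) / 2) +
    tsallisSummand q ((1 - Real.sqrt (1 - x ^ 2)) / 2)

theorem concurrenceEntropy_zero {q : ℝ} (hq : 0 < q) : concurrenceEntropy q 0 = 0 := by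
  simp [concurrenceEntropy, tsallisSummand_zero hq, tsallisSummand_one]

theorem concurrenceEntropy_nonneg {q : ℝ} (hq : 0 < q) (x : ℝ) : 0 ≤ concurrenceEntropy q x := by
  have h0 := Real.sqrt_nonneg (1 - x ^ 2)
  have h1 : Real.sqrt (1 - x ^ 2) ≤ 1 := by
    rw [Real.sqrt_le_one]
    nlinarith [sq_nonneg x]
  exact add_nonneg (tsallisSummand_nonneg (by linarith) (by linarith) hq)
    (tsallisSummand_nonneg (by linarith) (by linarith) hq)

/-- The sign of the second derivative of `concurrenceEntropy q` in the variable `s = √(1 - x²)`: the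
difference of the two sides vanishes at `s = 0` and has the derivative controlled by
`rpow_combination_nonneg`. -/
theorem mul_rpow_add_le_tsallisSummandDeriv_sub {q s : ℝ} (hq0 : 0 < q)
    (hq : (q - 2) ^ 2 ≤ q + 1) (hs0 : 0 ≤ s) (hs1 : s < 1) :
    s * (1 - s ^ 2) * (q / 2 * (((1 + s) / 2) ^ (q - 2) + ((1 - s) / 2) ^ (q - 2))) ≤
      tsallisSummandDeriv q ((1 - s) / 2) - tsallisSummandDeriv q ((1 + s) / 2) := by
  have hd : ∀ t ∈ Set.Icc 0 s, HasDerivAt (fun t =>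
      (tsallisSummandDeriv q ((1 - t) / 2) - tsallisSummandDeriv q ((1 + t) / 2)) -
      (t - t ^ 3) * (q / 2 * (((1 + t) / 2) ^ (q - 2) + ((1 - t) / 2) ^ (q - 2))))
      ((-q * ((1 - t) / 2) ^ (q - 2) * (-1 / 2) - -q * ((1 + t) / 2) ^ (q - 2) * (1 / 2)) -
       ((1 - 3 * t ^ 2) * (q / 2 * (((1 + t) / 2) ^ (q - 2) + ((1 - t) / 2) ^ (q - 2))) +
        (t - t ^ 3) * (q / 2 * (1 / 2 * (q - 2) * ((1 + t) / 2) ^ (q - 2 - 1) +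
          -1 / 2 * (q - 2) * ((1 - t) / 2) ^ (q - 2 - 1))))) t := by
    intro t ht
    have ht0 := ht.1
    have ht1 := ht.2
    have hp : HasDerivAt (fun t : ℝ => (1 + t) / 2) (1 / 2) t :=
      ((hasDerivAt_id' t).const_add 1).div_const 2
    have hm : HasDerivAt (fun t : ℝ => (1 - t) / 2) (-1 / 2) t :=
      ((hasDerivAt_id' t).const_sub 1).div_const 2
    have hp0 : 0 < (1 + t) / 2 := by linarith
    have hm0 : 0 < (1 - t) / 2 := by linarith
    refine HasDerivAt.sub (HasDerivAt.sub ?_ ?_)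
      (HasDerivAt.mul ?_ ((HasDerivAt.add ?_ ?_).const_mul _))
    · exact (hasDerivAt_tsallisSummandDeriv q hm0).comp t hm
    · exact (hasDerivAt_tsallisSummandDeriv q hp0).comp t hp
    · exact ((hasDerivAt_id' t).sub (hasDerivAt_pow 3 t)).congr_deriv (by norm_num)
    · exact hp.rpow_const (Or.inl hp0.ne')
    · exact hm.rpow_const (Or.inl hm0.ne')
  have hmono : MonotoneOn (fun t =>
      (tsallisSummandDeriv q ((1 - t) / 2) - tsallisSummandDeriv q ((1 + t) / 2)) -
      (t - t ^ 3) * (q / 2 * (((1 + t) / 2) ^ (q - 2) + ((1 - t) / 2) ^ (q - 2))))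
      (Set.Icc 0 s) := by
    apply monotoneOn_of_deriv_nonneg (convex_Icc 0 s)
    · exact fun t ht => (hd t ht).continuousAt.continuousWithinAt
    · exact fun t ht => (hd t (interior_subset ht)).differentiableAt.differentiableWithinAt
    · intro t ht
      have ht' := interior_subset ht
      rw [(hd t ht').deriv]
      have ht0 := ht'.1
      have ht1 : t < 1 := ht'.2.trans_lt hs1
      have hp0 : 0 < 1 + t := by linarith
      have hm0 : 0 < 1 - t := by linarith
      have key := rpow_combination_nonneg hq0 hq ht0 ht1
      rw [Real.rpow_sub_one (by positivity), Real.rpow_sub_one (by positivity),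
        Real.div_rpow hp0.le zero_le_two, Real.div_rpow hm0.le zero_le_two]
      have h2 : (0 : ℝ) < 2 ^ (q - 2) := by positivity
      generalize (1 + t) ^ (q - 2) = A at *
      generalize (1 - t) ^ (q - 2) = B at *
      generalize (2 : ℝ) ^ (q - 2) = c at *
      have : (-q * (B / c) * (-1 / 2) - -q * (A / c) * (1 / 2)) -
       ((1 - 3 * t ^ 2) * (q / 2 * (A / c + B / c)) +
        (t - t ^ 3) * (q / 2 * (1 / 2 * (q - 2) * (A / c / ((1 + t) / 2)) +
          -1 / 2 * (q - 2) * (B / c / ((1 - t) / 2))))) =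
          t * q / (2 * c) * (A * ((q + 1) * t - (q - 2)) + B * ((q + 1) * t + (q - 2))) := by
        field_simp
        ring
      rw [this]
      positivity
  have h0 := hmono ⟨le_rfl, hs0⟩ ⟨hs0, le_rfl⟩ hs0
  simp only [sub_zero, add_zero, sub_self] at h0
  norm_num at h0
  nlinarith [h0]

theorem convexOn_concurrenceEntropy {q : ℝ} (hq0 : 0 < q) (hq : (q - 2) ^ 2 ≤ q + 1) :
    ConvexOn ℝ (Set.Icc 0 1) (concurrenceEntropy q) := by
  have hs : ∀ x ∈ Set.Ioo (0 : ℝ) 1, 0 < 1 - x ^ 2 := by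
    intro x hx
    nlinarith [hx.1, hx.2]
  have hsd : ∀ x ∈ Set.Ioo (0 : ℝ) 1, HasDerivAt (fun x : ℝ => Real.sqrt (1 - x ^ 2))
      (-x / Real.sqrt (1 - x ^ 2)) x := by
    intro x hx
    refine (((hasDerivAt_pow 2 x).const_sub 1).sqrt (hs x hx).ne').congr_deriv ?_
    field_simp
    simp
  refine convexOn_of_hasDerivWithinAt2_nonneg (convex_Icc 0 1)
    (f' := fun x => x / (2 * Real.sqrt (1 - x ^ 2)) *
      (tsallisSummandDeriv q ((1 - Real.sqrt (1 - x ^ 2)) / 2) -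
        tsallisSummandDeriv q ((1 + Real.sqrt (1 - x ^ 2)) / 2)))
    (f'' := fun x => 1 / (2 * Real.sqrt (1 - x ^ 2) ^ 3) *
      ((tsallisSummandDeriv q ((1 - Real.sqrt (1 - x ^ 2)) / 2) -
        tsallisSummandDeriv q ((1 + Real.sqrt (1 - x ^ 2)) / 2)) -
       Real.sqrt (1 - x ^ 2) * x ^ 2 *
        (q / 2 * (((1 + Real.sqrt (1 - x ^ 2)) / 2) ^ (q - 2) +
          ((1 - Real.sqrt (1 - x ^ 2)) / 2) ^ (q - 2))))) ?_ ?_ ?_ ?_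
  · have := continuous_tsallisSummand hq0
    unfold concurrenceEntropy
    fun_prop
  all_goals
    rw [interior_Icc]
    intro x hx
    have hpos := hs x hx
    have hsx := hsd x hx
    have hs0 : 0 < Real.sqrt (1 - x ^ 2) := Real.sqrt_pos.mpr hpos
    have hsq : Real.sqrt (1 - x ^ 2) ^ 2 = 1 - x ^ 2 := Real.sq_sqrt hpos.le
    have hs1 : Real.sqrt (1 - x ^ 2) < 1 := by
      nlinarith [hx.1]
    have hp0 : 0 < (1 + Real.sqrt (1 - x ^ 2)) / 2 := by linarith
    have hm0 : 0 < (1 - Real.sqrt (1 - x ^ 2)) / 2 := by linarith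
    have hp := (hsx.const_add 1).div_const 2
    have hm := (hsx.const_sub 1).div_const 2
  · refine HasDerivAt.hasDerivWithinAt ?_
    have h1 := ((hasDerivAt_tsallisSummand q hp0).comp x hp).add
      ((hasDerivAt_tsallisSummand q hm0).comp x hm)
    refine h1.congr_deriv ?_
    field_simp
    ring
  · refine HasDerivAt.hasDerivWithinAt ?_
    have h1 := ((hasDerivAt_tsallisSummandDeriv q hm0).comp x hm).sub
      ((hasDerivAt_tsallisSummandDeriv q hp0).comp x hp)
    have h2 := (hasDerivAt_id' x).div (hsx.const_mul 2) (by positivity)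
    refine (h2.mul h1).congr_deriv ?_
    simp only [Function.comp_apply, Pi.sub_apply, Pi.div_apply]
    have hx2 : x ^ 2 = 1 - Real.sqrt (1 - x ^ 2) ^ 2 := by linarith
    generalize hS : Real.sqrt (1 - x ^ 2) = S at *
    generalize ((1 + S) / 2) ^ (q - 2) = A
    generalize ((1 - S) / 2) ^ (q - 2) = B
    generalize tsallisSummandDeriv q ((1 - S) / 2) = C
    generalize tsallisSummandDeriv q ((1 + S) / 2) = D
    field_simp
    rw [hx2]
    ring
  · have key := mul_rpow_add_le_tsallisSummandDeriv_sub hq0 hq hs0.le hs1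
    rw [hsq, sub_sub_cancel] at key
    have : 0 ≤ 1 / (2 * Real.sqrt (1 - x ^ 2) ^ 3) := by positivity
    exact mul_nonneg this (by linarith)

/-- A convex function vanishing at `0` has `f x / x` monotone; hence `f²` is superadditive in
the square of its argument. -/
theorem sum_sq_le_sq_of_convexOn {ι : Type*} {f : ℝ → ℝ} (hf : ConvexOn ℝ (Set.Icc 0 1) f)
    (h0 : f 0 = 0) (hnn : ∀ x, 0 ≤ f x) (t : Finset ι) (x : ι → ℝ) (X : ℝ)
    (hx : ∀ i ∈ t, 0 ≤ x i) (hX0 : 0 ≤ X) (hX1 : X ≤ 1) (hX : X ^ 2 = ∑ i ∈ t, x i ^ 2) :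
    ∑ i ∈ t, f (x i) ^ 2 ≤ f X ^ 2 := by
  rcases hX0.eq_or_lt with rfl | hpos
  · have hz : ∀ i ∈ t, x i ^ 2 = 0 :=
      (Finset.sum_eq_zero_iff_of_nonneg fun i _ => sq_nonneg (x i)).mp (by rw [← hX]; simp)
    rw [Finset.sum_eq_zero]
    · positivity
    · intro i hi
      rw [pow_eq_zero_iff two_ne_zero |>.mp (hz i hi), h0]
      simp
  · have hle : ∀ i ∈ t, f (x i) ≤ x i / X * f X := by
      intro i hi
      have h1 : x i ^ 2 ≤ X ^ 2 := by
        rw [hX]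
        exact Finset.single_le_sum (f := fun i => x i ^ 2) (fun j _ => sq_nonneg (x j)) hi
      have h2 : x i ≤ X := le_of_sq_le_sq h1 hX0
      have h3 := hf.2 (Set.left_mem_Icc.mpr zero_le_one) (show X ∈ Set.Icc (0 : ℝ) 1 from ⟨hX0, hX1⟩)
        (show 0 ≤ 1 - x i / X by rw [sub_nonneg, div_le_one hpos]; exact h2)
        (div_nonneg (hx i hi) hX0) (by ring)
      simpa [h0, hpos.ne'] using h3
    calc ∑ i ∈ t, f (x i) ^ 2 ≤ ∑ i ∈ t, (x i / X * f X) ^ 2 :=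
          Finset.sum_le_sum fun i hi => pow_le_pow_left₀ (hnn _) (hle i hi) 2
      _ = (∑ i ∈ t, x i ^ 2) / X ^ 2 * f X ^ 2 := by
          rw [Finset.sum_div, Finset.sum_mul]
          exact Finset.sum_congr rfl fun i _ => by ring
      _ = f X ^ 2 := by rw [← hX, div_self (by positivity), one_mul]

/-! ### Power inequalities -/

/-- The increments of a convex function over intervals of equal length are monotone. -/
theorem ConvexOn.increment_le {f : ℝ → ℝ} (hf : ConvexOn ℝ (Set.Ici 0) f) {a x h : ℝ}
    (ha : 0 ≤ a) (hax : a ≤ x) (hh : 0 < h) : f (a + h) - f a ≤ f (x + h) - f x := by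
  have hpos : 0 < x + h - a := by linarith
  have hA : a ∈ Set.Ici (0 : ℝ) := ha
  have hX : x + h ∈ Set.Ici (0 : ℝ) := Set.mem_Ici.mpr (by linarith)
  have h0 : 0 ≤ h / (x + h - a) := by positivity
  have h1 : 0 ≤ 1 - h / (x + h - a) := by
    rw [sub_nonneg, div_le_one hpos]
    linarith
  have e1 := hf.2 hA hX h1 h0 (by ring)
  have e2 := hf.2 hA hX h0 h1 (by ring)
  have p1 : (1 - h / (x + h - a)) • a + (h / (x + h - a)) • (x + h) = a + h := by
    simp only [smul_eq_mul]
    field_simp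
    ring
  have p2 : (h / (x + h - a)) • a + (1 - h / (x + h - a)) • (x + h) = x := by
    simp only [smul_eq_mul]
    field_simp
    ring
  rw [p1] at e1
  rw [p2] at e2
  simp only [smul_eq_mul] at e1 e2
  linarith

/-- The increment of `t ↦ t ^ s` from `x` to `x + y` is at least that from `y / k` to `y / k + y`,
which is the second summand on the left. -/
theorem rpow_add_le_rpow_add_of_le_mul {k s x y : ℝ} (hk : 0 < k) (hs : 1 ≤ s)
    (hy : 0 ≤ y) (hyx : y ≤ k * x) :
    x ^ s + ((1 + k) ^ s - 1) / k ^ s * y ^ s ≤ (x + y) ^ s := by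
  rcases hy.eq_or_lt with rfl | hy
  · simp [Real.zero_rpow (by linarith : s ≠ 0)]
  · have h := (convexOn_rpow hs).increment_le (a := y / k) (x := x) (by positivity)
      (by rwa [div_le_iff₀' hk]) hy
    have h1 : y / k + y = y / k * (1 + k) := by field_simp
    simp only [h1] at h
    rw [Real.mul_rpow (by positivity) (by positivity), Real.div_rpow hy.le hk.le] at h
    have h2 : ((1 + k) ^ s - 1) / k ^ s * y ^ s = y ^ s / k ^ s * (1 + k) ^ s - y ^ s / k ^ s := by
      ring
    linarith

theorem one_le_Kfactor {k β : ℝ} (hβ : 2 ≤ β) (hk0 : 0 < k) : 1 ≤ Kfactor k β := by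
  rw [Kfactor, le_div_iff₀ (by positivity)]
  have := Real.add_rpow_le_rpow_add (zero_le_one' ℝ) hk0.le (by linarith : 1 ≤ β / 2)
  simp only [Real.one_rpow] at this
  linarith

theorem sum_Kfactor_pow_mul_rpow_le {k β : ℝ} (hk0 : 0 < k) (hβ : 2 ≤ β) {r : ℕ}
    (x : Fin r → ℝ) (hx : ∀ j, 0 ≤ x j) (h : ∀ l, ∑ j ∈ Finset.Ioi l, x j ≤ k * x l) :
    ∑ j : Fin r, Kfactor k β ^ (j : ℕ) * x j ^ (β / 2) ≤ (∑ j, x j) ^ (β / 2) := by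
  have hK : 0 ≤ Kfactor k β := zero_le_one.trans (one_le_Kfactor hβ hk0)
  induction r with
  | zero => simpa using Real.rpow_nonneg le_rfl _
  | succ r ih =>
    have h0 := h 0
    rw [Fin.Ioi_zero_eq_map, Finset.sum_map] at h0
    simp only [Fin.coe_succEmb] at h0
    have ih' := ih (fun j => x j.succ) (fun j => hx _) (fun l => by
      have hl := h l.succ
      rw [← Fin.map_succEmb_Ioi, Finset.sum_map] at hl
      simpa using hl)
    rw [Fin.sum_univ_succ, Fin.sum_univ_succ]
    refine le_trans ?_ (rpow_add_le_rpow_add_of_le_mul hk0 (by linarith)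
      (Finset.sum_nonneg fun j _ => hx _) h0)
    have h1 := mul_le_mul_of_nonneg_left ih' hK
    rw [Finset.mul_sum] at h1
    simp only [Fin.val_zero, pow_zero, one_mul, Fin.val_succ, pow_succ']
    simp only [← mul_assoc] at h1
    rw [Kfactor] at *
    linarith

theorem hammingWeight_le (j : ℕ) : hammingWeight j ≤ j := by
  have h : ∀ l : List ℕ, l.count 1 ≤ l.sum := by
    intro l
    induction l with
    | nil => simp
    | cons a l ih =>
      rw [List.count_cons, List.sum_cons]
      split_ifs with ha
      · rw [beq_iff_eq] at ha
        omega
      · omega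
  exact (h _).trans (Nat.digit_sum_le 2 j)

/-! ### Spectra of matrices of rank at most two -/

/-- If `M = V W` factors through a two-dimensional space and `W V` has characteristic polynomial
`(X - l₁)(X - l₂)`, then up to zeros the eigenvalues of `M` are `l₁` and `l₂`. -/
theorem Matrix.IsHermitian.sum_eigenvalues_of_mul_fin_two {α : Type*} [Fintype α] [DecidableEq α]
    {M : Matrix α α ℂ} (hM : M.IsHermitian) (V : Matrix α (Fin 2) ℂ) (W : Matrix (Fin 2) α ℂ)
    (hVW : M = V * W) {l₁ l₂ : ℝ} (htr : (W * V).trace = l₁ + l₂)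
    (hdet : (W * V).det = l₁ * l₂) (g : ℝ → ℝ) (hg : g 0 = 0) :
    ∑ i, g (hM.eigenvalues i) = g l₁ + g l₂ := by
  have h1 := Matrix.charpoly_mul_comm' V W
  rw [← hVW] at h1
  have h2 : (W * V).charpoly =
      (Polynomial.X - Polynomial.C (l₁ : ℂ)) * (Polynomial.X - Polynomial.C (l₂ : ℂ)) := by
    rw [Matrix.charpoly_fin_two, htr, hdet, Polynomial.C_add, Polynomial.C_mul]
    ring
  have h3 := congrArg Polynomial.roots h1
  have hne : ∀ m : ℕ, (Polynomial.X : Polynomial ℂ) ^ m ≠ 0 := fun m =>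
    pow_ne_zero m Polynomial.X_ne_zero
  rw [Polynomial.roots_mul (mul_ne_zero (hne _) (Matrix.charpoly_monic _).ne_zero),
    Polynomial.roots_mul (mul_ne_zero (hne _) (Matrix.charpoly_monic _).ne_zero), h2,
    Polynomial.roots_mul (mul_ne_zero (Polynomial.X_sub_C_ne_zero _)
      (Polynomial.X_sub_C_ne_zero _)), hM.roots_charpoly_eq_eigenvalues] at h3
  have h4 := congrArg (fun s => (s.map fun z : ℂ => g z.re).sum) h3
  simpa [Polynomial.roots_X_sub_C, Polynomial.roots_pow, Multiset.map_nsmul, Multiset.sum_nsmul,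
    hg, Function.comp_def, Multiset.map_map] using h4

theorem tsallisEntropy_eq_sum_tsallisSummand {α : Type} [Fintype α] [DecidableEq α] (q : ℝ)
    {ρ : Matrix α α ℂ} (hρ : ρ.IsHermitian) (htr : ∑ i, hρ.eigenvalues i = 1) :
    tsallisEntropy q ρ hρ = ∑ i, tsallisSummand q (hρ.eigenvalues i) := by
  rw [tsallisEntropy]
  simp only [tsallisSummand]
  split_ifs with h
  · rfl
  · rw [← Finset.sum_div, Finset.sum_sub_distrib, htr]

/-- A bipartite vector whose amplitudes vanish when both parties are excited. -/
def NoDoubleExcitation {α β : Type} [Zero α] [Zero β] (φ : α × β → ℂ) : Prop :=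
  ∀ x y, x ≠ 0 → y ≠ 0 → φ (x, y) = 0

/-- The weight of the excitations of the first party. -/
noncomputable def leftWeight {α β : Type} [Fintype α] [DecidableEq α] [Zero α] [Zero β] (φ : α × β → ℂ) : ℝ :=
  ∑ x ∈ Finset.univ.erase 0, ‖φ (x, 0)‖ ^ 2

/-- The weight of the excitations of the second party. -/
noncomputable def rightWeight {α β : Type} [Fintype β] [DecidableEq β] [Zero α] [Zero β] (φ : α × β → ℂ) : ℝ :=
  ∑ y ∈ Finset.univ.erase 0, ‖φ (0, y)‖ ^ 2

theorem leftWeight_nonneg {α β : Type} [Fintype α] [DecidableEq α] [Zero α] [Zero β]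
    (φ : α × β → ℂ) : 0 ≤ leftWeight φ :=
  Finset.sum_nonneg fun _ _ => by positivity

theorem rightWeight_nonneg {α β : Type} [Fintype β] [DecidableEq β] [Zero α] [Zero β]
    (φ : α × β → ℂ) : 0 ≤ rightWeight φ :=
  Finset.sum_nonneg fun _ _ => by positivity

theorem NoDoubleExcitation.sum_norm_sq {α β : Type} [Fintype α] [DecidableEq α] [Fintype β]
    [DecidableEq β] [Zero α] [Zero β] {φ : α × β → ℂ} (hφ : NoDoubleExcitation φ) :
    ∑ u, ‖φ u‖ ^ 2 = ‖φ (0, 0)‖ ^ 2 + leftWeight φ + rightWeight φ := by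
  rw [Fintype.sum_prod_type, ← Finset.add_sum_erase _ _ (Finset.mem_univ (0 : α)),
    ← Finset.add_sum_erase _ _ (Finset.mem_univ (0 : β)), leftWeight, rightWeight, add_right_comm]
  congr 1
  congr 1
  refine Finset.sum_congr rfl fun x hx => ?_
  refine Finset.sum_eq_single_of_mem 0 (Finset.mem_univ _) fun y _ hy => ?_
  simp [hφ x y (Finset.ne_of_mem_erase hx) hy]

/-- The reduced density matrix of such a vector is supported on the span of `|0⟩` and the
excitation `w`, where it has trace `1` and determinant `leftWeight φ * rightWeight φ`: the
concurrence is `2 √(leftWeight φ * rightWeight φ)`. -/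
theorem NoDoubleExcitation.pureTqE_eq {α β : Type} [Fintype α] [DecidableEq α] [Fintype β]
    [DecidableEq β] [Zero α] [Zero β] {φ : α × β → ℂ} (hφ : NoDoubleExcitation φ)
    (hnorm : ∑ u, ‖φ u‖ ^ 2 = 1) (q : ℝ) (hq : 0 < q) :
    pureTqE q φ = concurrenceEntropy q (2 * Real.sqrt (leftWeight φ * rightWeight φ)) := by
  have hsum := hnorm
  rw [hφ.sum_norm_sq] at hsum
  have hA := leftWeight_nonneg φ
  have hB := rightWeight_nonneg φ
  have hAB := mul_nonneg hA hB
  set a := leftWeight φ with ha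
  set b := rightWeight φ with hb
  set γ := φ (0, 0) with hγ
  have hle : a + b ≤ 1 := by nlinarith [sq_nonneg ‖γ‖]
  have hC : 1 - (2 * Real.sqrt (a * b)) ^ 2 = 1 - 4 * (a * b) := by
    rw [mul_pow, Real.sq_sqrt hAB]
    ring
  have hD : 0 ≤ 1 - 4 * (a * b) := by nlinarith [sq_nonneg (a - b)]
  have hs : Real.sqrt (1 - 4 * (a * b)) ^ 2 = 1 - 4 * (a * b) := Real.sq_sqrt hD
  set s := Real.sqrt (1 - 4 * (a * b)) with hs_def
  -- `w` is the excited part of the first party; `φ = |0⟩ ⊗ φ(0, ·) + w ⊗ |0⟩` gives the factorization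
  -- of the reduced density matrix through `Fin 2`.
  let w : α → ℂ := fun x => if x = 0 then 0 else φ (x, 0)
  let V : Matrix α (Fin 2) ℂ := Matrix.of fun x => ![if x = 0 then 1 else 0, w x]
  let W : Matrix (Fin 2) α ℂ :=
    Matrix.of ![fun x => ∑ y, φ (0, y) * star (φ (x, y)), fun x => star (φ (x, 0))]
  have hVW : reducedLeft φ = V * W := by
    ext x x'
    simp only [reducedLeft, Matrix.mul_apply, ampMatrix, Matrix.of_apply,
      Matrix.conjTranspose_apply, V, W, Fin.sum_univ_two, Matrix.cons_val_zero,
      Matrix.cons_val_one, w]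
    by_cases hx : x = 0
    · simp [hx]
    · simp only [hx, if_false, zero_mul, zero_add]
      refine Finset.sum_eq_single_of_mem 0 (Finset.mem_univ _) fun y _ hy => ?_
      simp [hφ x y hx hy]
  have hww : ∑ x, star (φ (x, 0)) * w x = (a : ℂ) := by
    rw [← Finset.add_sum_erase _ _ (Finset.mem_univ (0 : α)), ha, leftWeight]
    simp only [w, if_true, mul_zero, zero_add]
    push_cast
    refine Finset.sum_congr rfl fun x hx => ?_
    rw [if_neg (Finset.ne_of_mem_erase hx), Complex.star_def, Complex.conj_mul']
  have hu : ∑ y, φ (0, y) * star (φ (0, y)) = (‖γ‖ : ℂ) ^ 2 + b := by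
    rw [← Finset.add_sum_erase _ _ (Finset.mem_univ (0 : β)), hb, rightWeight]
    push_cast
    simp only [Complex.star_def, Complex.mul_conj']
    rfl
  have h00 : (W * V) 0 0 = (‖γ‖ : ℂ) ^ 2 + b := by
    rw [← hu, Matrix.mul_apply]
    simp [V, W]
  have h01 : (W * V) 0 1 = γ * a := by
    rw [Matrix.mul_apply, ← hww, Finset.mul_sum]
    refine Finset.sum_congr rfl fun x _ => ?_
    simp only [W, V, Matrix.of_apply, Matrix.cons_val_zero, Matrix.cons_val_one, w]
    by_cases hx : x = 0
    · simp [hx]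
    · simp only [hx, if_false]
      rw [Finset.sum_eq_single_of_mem 0 (Finset.mem_univ _) fun y _ hy => by
        simp [hφ x y hx hy], mul_assoc]
  have h10 : (W * V) 1 0 = star γ := by
    rw [Matrix.mul_apply]
    simp [V, W, hγ]
  have h11 : (W * V) 1 1 = a := by
    rw [Matrix.mul_apply, ← hww]
    simp [V, W]
  have htr : (W * V).trace = (((1 + s) / 2 : ℝ) : ℂ) + (((1 - s) / 2 : ℝ) : ℂ) := by
    rw [Matrix.trace_fin_two, h00, h11]
    rw [← Complex.ofReal_add, show (1 + s) / 2 + (1 - s) / 2 = ‖γ‖ ^ 2 + a + b by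
      rw [hsum]; ring]
    push_cast
    ring
  have hdet : (W * V).det = (((1 + s) / 2 : ℝ) : ℂ) * (((1 - s) / 2 : ℝ) : ℂ) := by
    rw [Matrix.det_fin_two, h00, h11, h01, h10, ← Complex.ofReal_mul,
      show (1 + s) / 2 * ((1 - s) / 2) = a * b by nlinarith, mul_right_comm, Complex.star_def,
      Complex.mul_conj']
    push_cast
    ring
  have key := (reducedLeft_isHermitian φ).sum_eigenvalues_of_mul_fin_two V W hVW htr hdet
  rw [pureTqE, tsallisEntropy_eq_sum_tsallisSummand, key _ (tsallisSummand_zero hq),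
    concurrenceEntropy, hC]
  rw [key (fun x => x) rfl]
  ring

/-! ### The convex roof -/

theorem NoDoubleExcitation.weights_of_eq_mul {α β : Type} [Fintype α] [DecidableEq α] [Fintype β]
    [DecidableEq β] [Zero α] [Zero β] {ξ φ : α × β → ℂ}
    (hξ : NoDoubleExcitation ξ) {c : ℂ}
    (h : ∀ u, u ≠ (0, 0) → φ u = c * ξ u) :
    NoDoubleExcitation φ ∧ leftWeight φ = ‖c‖ ^ 2 * leftWeight ξ ∧
      rightWeight φ = ‖c‖ ^ 2 * rightWeight ξ := by
  refine ⟨fun x y hx hy => ?_, ?_, ?_⟩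
  · rw [h _ (by simp [hx]), hξ x y hx hy, mul_zero]
  · rw [leftWeight, leftWeight, Finset.mul_sum]
    refine Finset.sum_congr rfl fun x hx => ?_
    rw [h _ (by simp [Finset.ne_of_mem_erase hx]), norm_mul, mul_pow]
  · rw [rightWeight, rightWeight, Finset.mul_sum]
    refine Finset.sum_congr rfl fun x hx => ?_
    rw [h _ (by simp [Finset.ne_of_mem_erase hx]), norm_mul, mul_pow]

/-- If `ρ` agrees with `|ξ⟩⟨ξ|` outside the vacuum, every vector in a pure state decomposition of
`ρ` is, outside the vacuum, a multiple of `ξ`: the vectors orthogonal to `ξ` there lie in the kernel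
of `ρ`. The squared moduli of the multiples average to `1`. -/
theorem IsPureDecomposition.exists_smul {κ : Type} [Fintype κ] {ρ : Matrix κ κ ℂ} {N : ℕ}
    {w : Fin N → ℝ} {φ : Fin N → κ → ℂ} (h : IsPureDecomposition ρ w φ) (S : Set κ)
    (ξ : κ → ℂ) (hρ : ∀ u ∈ S, ∀ v ∈ S, ρ u v = ξ u * star (ξ v)) {v : κ} (hv : v ∈ S)
    (hξv : ξ v ≠ 0) :
    ∃ c : Fin N → ℂ, ∑ i, w i * ‖c i‖ ^ 2 = 1 ∧
      ∀ i, 0 < w i → ∀ u ∈ S, φ i u = c i * ξ u := by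
  obtain ⟨hw, -, -, hdec⟩ := h
  have hent : ∀ u ∈ S, ∀ u' ∈ S, ∑ i, (w i : ℂ) * (φ i u * star (φ i u')) = ξ u * star (ξ u') := by
    intro u hu u' hu'
    rw [← hρ u hu u' hu', hdec, Matrix.sum_apply]
    simp [Matrix.vecMulVec_apply]
  have hn : ∀ u ∈ S, ∀ u' ∈ S, ∀ i, 0 < w i → ξ u' * φ i u = ξ u * φ i u' := by
    intro u hu u' hu' i hi
    have hz : ∑ i, w i * ‖ξ u' * φ i u - ξ u * φ i u'‖ ^ 2 = 0 := by
      have : ((∑ i, w i * ‖ξ u' * φ i u - ξ u * φ i u'‖ ^ 2 : ℝ) : ℂ) =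
          ξ u' * star (ξ u') * ∑ i, (w i : ℂ) * (φ i u * star (φ i u)) -
          ξ u' * star (ξ u) * ∑ i, (w i : ℂ) * (φ i u * star (φ i u')) -
          ξ u * star (ξ u') * ∑ i, (w i : ℂ) * (φ i u' * star (φ i u)) +
          ξ u * star (ξ u) * ∑ i, (w i : ℂ) * (φ i u' * star (φ i u')) := by
        push_cast
        simp only [Finset.mul_sum, ← Finset.sum_sub_distrib, ← Finset.sum_add_distrib]
        refine Finset.sum_congr rfl fun i _ => ?_
        rw [← Complex.mul_conj', ← Complex.star_def]
        simp only [star_sub, star_mul']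
        ring
      rw [hent u hu u hu, hent u hu u' hu', hent u' hu' u hu, hent u' hu' u' hu'] at this
      rw [← Complex.ofReal_eq_zero, this]
      ring
    have hi0 := (Finset.sum_eq_zero_iff_of_nonneg fun i _ =>
      mul_nonneg (hw i) (sq_nonneg ‖ξ u' * φ i u - ξ u * φ i u'‖)).mp hz i (Finset.mem_univ i)
    have := (mul_eq_zero.mp hi0).resolve_left hi.ne'
    rw [pow_eq_zero_iff two_ne_zero, norm_eq_zero, sub_eq_zero] at this
    exact this
  refine ⟨fun i => φ i v / ξ v, ?_, fun i hi u hu => ?_⟩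
  · have h1 := hent v hv v hv
    have hnv : ‖ξ v‖ ≠ 0 := norm_ne_zero_iff.mpr hξv
    have h2 : ∑ i, w i * ‖φ i v‖ ^ 2 = ‖ξ v‖ ^ 2 := by
      rw [← Complex.ofReal_inj]
      push_cast
      simpa only [Complex.star_def, Complex.mul_conj'] using h1
    simp only [norm_div, div_pow, mul_div_assoc']
    rw [← Finset.sum_div, h2, div_self (by positivity)]
  · have := hn u hu v hv i hi
    field_simp
    linear_combination this

/-- The vectors `ξ ± i√μ |0⟩` have the same norm because `ξ 0` is real. -/
theorem isPureDecomposition_half {κ : Type} [Fintype κ] [DecidableEq κ] {ρ : Matrix κ κ ℂ}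
    {ξ : κ → ℂ} {o : κ} {μ c : ℝ} (hμ : 0 ≤ μ) (hc : ξ o = c)
    (hρ : ∀ u v, ρ u v = ξ u * star (ξ v) + if u = o ∧ v = o then (μ : ℂ) else 0)
    (hnorm : ∑ u, ‖ξ u‖ ^ 2 + μ = 1) :
    IsPureDecomposition ρ ![1 / 2, 1 / 2]
      ![fun u => ξ u + if u = o then Complex.I * Real.sqrt μ else 0,
        fun u => ξ u - if u = o then Complex.I * Real.sqrt μ else 0] := by
  have hsq : ((Real.sqrt μ : ℝ) : ℂ) ^ 2 = μ := by
    rw [← Complex.ofReal_pow, Real.sq_sqrt hμ]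
  have hn : ∀ ε : ℝ, ε ^ 2 = 1 →
      ∑ u, ‖ξ u + ε * if u = o then Complex.I * Real.sqrt μ else 0‖ ^ 2 = 1 := by
    intro ε hε
    rw [← Finset.add_sum_erase _ _ (Finset.mem_univ o)] at hnorm ⊢
    have h1 : ∑ u ∈ Finset.univ.erase o,
          ‖ξ u + ε * if u = o then Complex.I * Real.sqrt μ else 0‖ ^ 2 =
        ∑ u ∈ Finset.univ.erase o, ‖ξ u‖ ^ 2 := by
      refine Finset.sum_congr rfl fun u hu => ?_
      simp [Finset.ne_of_mem_erase hu]
    rw [h1, if_pos rfl, hc, ← hnorm, hc, ← Complex.normSq_eq_norm_sq, ← Complex.normSq_eq_norm_sq,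
      Complex.normSq_apply, Complex.normSq_apply]
    simp
    have := Real.sq_sqrt hμ
    linear_combination ε ^ 2 * this + μ * hε
  refine ⟨?_, ?_, ?_, ?_⟩
  · intro i
    fin_cases i <;> simp
  · norm_num [Fin.sum_univ_two]
  · intro i
    fin_cases i
    · simpa using hn 1 (by norm_num)
    · have := hn (-1) (by norm_num)
      simp only [Complex.ofReal_neg, Complex.ofReal_one, neg_one_mul, ← sub_eq_add_neg] at this
      exact this
  · ext u v
    rw [hρ]
    simp only [Fin.sum_univ_two, Matrix.add_apply, Matrix.smul_apply, Matrix.vecMulVec_apply,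
      Matrix.cons_val_zero, Matrix.cons_val_one, Pi.star_apply, smul_eq_mul]
    have hI := Complex.I_sq
    by_cases hu : u = o <;> by_cases hv : v = o <;> simp [hu, hv] <;> ring_nf
    rw [hI, hsq]
    ring

/-- The entanglement of a state `|ξ⟩⟨ξ| + μ |0⟩⟨0|`, for `ξ` without double excitations. In every
decomposition the concurrences average to that of `ξ`, so convexity of `concurrenceEntropy` gives
the lower bound, and the decomposition into `ξ ± i√μ |0⟩` attains it. -/
theorem TqE_eq_concurrenceEntropy {α β : Type} [Fintype α] [DecidableEq α] [Fintype β]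
    [DecidableEq β] [Zero α] [Zero β] {q : ℝ} (hq0 : 0 < q) (hq : (q - 2) ^ 2 ≤ q + 1)
    {ρ : Matrix (α × β) (α × β) ℂ} {ξ : α × β → ℂ} {μ c : ℝ} (hξ : NoDoubleExcitation ξ)
    (hμ : 0 ≤ μ) (hc : ξ (0, 0) = c)
    (hρ : ∀ u v, ρ u v = ξ u * star (ξ v) + if u = (0, 0) ∧ v = (0, 0) then (μ : ℂ) else 0)
    (hnorm : c ^ 2 + leftWeight ξ + rightWeight ξ + μ = 1) :
    TqE q ρ = concurrenceEntropy q (2 * Real.sqrt (leftWeight ξ * rightWeight ξ)) := by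
  have hA := leftWeight_nonneg ξ
  have hB := rightWeight_nonneg ξ
  have hnorm' : ∑ u, ‖ξ u‖ ^ 2 + μ = 1 := by
    rw [hξ.sum_norm_sq, hc, Complex.norm_real, Real.norm_eq_abs, sq_abs, hnorm]
  refine IsLeast.csInf_eq ⟨?_, ?_⟩
  · have hdec := isPureDecomposition_half hμ hc hρ hnorm'
    refine ⟨2, _, _, hdec, ?_⟩
    have hval : ∀ i, pureTqE q ((![fun u => ξ u + if u = (0, 0) then Complex.I * Real.sqrt μ else 0,
        fun u => ξ u - if u = (0, 0) then Complex.I * Real.sqrt μ else 0] :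
          Fin 2 → α × β → ℂ) i) =
        concurrenceEntropy q (2 * Real.sqrt (leftWeight ξ * rightWeight ξ)) := by
      intro i
      obtain ⟨h1, h2, h3⟩ := NoDoubleExcitation.weights_of_eq_mul (c := 1) hξ
        (φ := (![fun u => ξ u + if u = (0, 0) then Complex.I * Real.sqrt μ else 0,
        fun u => ξ u - if u = (0, 0) then Complex.I * Real.sqrt μ else 0] :
          Fin 2 → α × β → ℂ) i) (by
          intro u hu
          fin_cases i <;> simp [hu])
      rw [h1.pureTqE_eq (hdec.2.2.1 i) q hq0, h2, h3]
      simp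
    simp only [hval]
    rw [← Finset.sum_mul, hdec.2.1, one_mul]
  · rintro t ⟨N, w, φ, hdec, rfl⟩
    have hnde : ∀ i, 0 < w i → NoDoubleExcitation (φ i) := by
      intro i hi x y hx hy
      have h1 : ∑ i, w i * ‖φ i (x, y)‖ ^ 2 = 0 := by
        rw [← Complex.ofReal_inj]
        have h2 := hρ (x, y) (x, y)
        rw [hξ x y hx hy, hdec.2.2.2, Matrix.sum_apply] at h2
        simpa [Matrix.vecMulVec_apply, Complex.mul_conj', hx] using h2
      have h2 := (Finset.sum_eq_zero_iff_of_nonneg fun i _ =>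
        mul_nonneg (hdec.1 i) (sq_nonneg ‖φ i (x, y)‖)).mp h1 i (Finset.mem_univ i)
      simpa [hi.ne'] using h2
    by_cases hz : ∀ u, u ≠ (0, 0) → ξ u = 0
    · have hA0 : leftWeight ξ = 0 := Finset.sum_eq_zero fun x hx => by
        rw [hz _ (by simp [Finset.ne_of_mem_erase hx])]
        simp
      rw [hA0, zero_mul, Real.sqrt_zero, mul_zero, concurrenceEntropy_zero hq0]
      refine Finset.sum_nonneg fun i _ => ?_
      rcases (hdec.1 i).eq_or_lt with hi | hi
      · rw [← hi, zero_mul]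
      · rw [(hnde i hi).pureTqE_eq (hdec.2.2.1 i) q hq0]
        exact mul_nonneg hi.le (concurrenceEntropy_nonneg hq0 _)
    · push Not at hz
      obtain ⟨v, hv, hξv⟩ := hz
      obtain ⟨a, ha1, ha⟩ := hdec.exists_smul {u | u ≠ (0, 0)} ξ
        (fun u hu v _ => by rw [hρ, if_neg (fun h => hu h.1), add_zero]) hv hξv
      set C := 2 * Real.sqrt (leftWeight ξ * rightWeight ξ) with hC
      have hC0 : 0 ≤ C := by positivity
      have hval : ∀ i, 0 < w i → pureTqE q (φ i) = concurrenceEntropy q (‖a i‖ ^ 2 * C) ∧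
          ‖a i‖ ^ 2 * C ≤ 1 := by
        intro i hi
        obtain ⟨h1, h2, h3⟩ := NoDoubleExcitation.weights_of_eq_mul hξ (ha i hi)
        have h4 := h1.sum_norm_sq
        rw [hdec.2.2.1 i] at h4
        have h5 : 2 * Real.sqrt (leftWeight (φ i) * rightWeight (φ i)) = ‖a i‖ ^ 2 * C := by
          rw [h2, h3, show ‖a i‖ ^ 2 * leftWeight ξ * (‖a i‖ ^ 2 * rightWeight ξ) =
            (‖a i‖ ^ 2) ^ 2 * (leftWeight ξ * rightWeight ξ) by ring,
            Real.sqrt_mul (by positivity), Real.sqrt_sq (by positivity), hC]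
          ring
        refine ⟨by rw [h1.pureTqE_eq (hdec.2.2.1 i) q hq0, h5], ?_⟩
        have h6 := leftWeight_nonneg (φ i)
        have h7 := rightWeight_nonneg (φ i)
        rw [← h5, Real.sqrt_mul h6]
        nlinarith [Real.sq_sqrt h6, Real.sq_sqrt h7, sq_nonneg ‖φ i (0, 0)‖,
          sq_nonneg (Real.sqrt (leftWeight (φ i)) - Real.sqrt (rightWeight (φ i)))]
      -- The vectors of zero weight are unconstrained; `0` stands in for their concurrence.
      let x : Fin N → ℝ := fun i => if 0 < w i then ‖a i‖ ^ 2 * C else 0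
      have hx : ∀ i, w i * x i = w i * ‖a i‖ ^ 2 * C := by
        intro i
        rcases (hdec.1 i).eq_or_lt with hi | hi
        · simp [← hi]
        · simp only [x, if_pos hi]
          ring
      have hj := (convexOn_concurrenceEntropy hq0 hq).map_sum_le (t := Finset.univ) (w := w)
        (p := x) (fun i _ => hdec.1 i) hdec.2.1 (by
          intro i _
          simp only [x]
          split_ifs with hi
          · exact ⟨by positivity, (hval i hi).2⟩
          · simp)
      simp only [smul_eq_mul, hx] at hj
      rw [← Finset.sum_mul, ha1, one_mul] at hj
      refine hj.trans_eq (Finset.sum_congr rfl fun i _ => ?_)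
      rcases (hdec.1 i).eq_or_lt with hi | hi
      · simp [← hi]
      · rw [(hval i hi).1]
        simp only [x, if_pos hi]

/-! ### Reduced states of superpositions of a `W`-class state and the vacuum -/

/-- A sum over the nonzero configurations reduces to those with a single excitation if the summand
vanishes on configurations with two of them. -/
theorem sum_ne_zero_eq_sum_single {ι M : Type*} [Fintype ι] [DecidableEq ι] [AddCommMonoid M]
    {d : ℕ} [NeZero d] (g : (ι → Fin d) → M) (hg : ∀ c s t, s ≠ t → c s ≠ 0 → c t ≠ 0 → g c = 0) :
    ∑ c ∈ Finset.univ.erase 0, g c =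
      ∑ s, ∑ i ∈ Finset.univ.filter (fun i : Fin d => i ≠ 0), g (Pi.single s i) := by
  rw [Finset.sum_sigma']
  symm
  refine Finset.sum_of_injOn (fun p => Pi.single p.1 p.2) ?_ ?_ ?_ (fun _ _ => rfl)
  · rintro ⟨s, i⟩ hi ⟨t, j⟩ hj h
    simp only [Finset.coe_sigma, Set.mem_sigma_iff, Finset.mem_coe, Finset.mem_filter,
      Finset.mem_univ, true_and] at hi hj
    simp only at h
    have hst : s = t := by
      by_contra hst
      have := congrFun h s
      rw [Pi.single_eq_same, Pi.single_eq_of_ne hst] at this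
      exact hi this
    subst hst
    rw [Pi.single_injective s h]
  · rintro ⟨s, i⟩ hi
    simpa using hi
  · intro c hc hc'
    obtain ⟨s, hs⟩ := Function.ne_iff.mp (Finset.ne_of_mem_erase hc)
    by_contra hne
    apply hc'
    refine ⟨⟨s, c s⟩, by simpa using hs, ?_⟩
    ext t
    by_cases hst : s = t
    · subst hst
      simp
    · have h0 : c t = 0 := by
        by_contra h
        exact hne (hg c s t hst hs h)
      simp [h0, Pi.single_eq_of_ne (Ne.symm hst)]

/-- The weight of the excitations located in `S`, for a vector with at most one excitation. -/
noncomputable def excitationWeight {n d : ℕ} [NeZero d] (ψ : QuditVec n d) (S : Finset (Fin n)) :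
    ℝ :=
  ∑ s ∈ S, ∑ i ∈ Finset.univ.filter (fun i : Fin d => i ≠ 0), ‖ψ (Pi.single s i)‖ ^ 2

theorem excitationWeight_nonneg {n d : ℕ} [NeZero d] (ψ : QuditVec n d) (S : Finset (Fin n)) :
    0 ≤ excitationWeight ψ S :=
  Finset.sum_nonneg fun _ _ => Finset.sum_nonneg fun _ _ => by positivity

theorem wVec_apply_eq_zero {n d : ℕ} [NeZero d] (a : Fin n → Fin d → ℂ) {c : Fin n → Fin d}
    (hc : ∀ s i, i ≠ 0 → c ≠ Pi.single s i) : wVec a c = 0 := by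
  simp only [wVec, Finset.sum_apply]
  refine Finset.sum_eq_zero fun s _ => Finset.sum_eq_zero fun i hi => ?_
  simp [ket, Pi.single_eq_of_ne (hc s i (Finset.mem_filter.mp hi).2)]

theorem wVec_apply_single {n d : ℕ} [NeZero d] (a : Fin n → Fin d → ℂ) (s : Fin n) {i : Fin d}
    (hi : i ≠ 0) : wVec a (Pi.single s i) = a s i := by
  simp only [wVec, Finset.sum_apply]
  rw [Finset.sum_eq_single_of_mem s (Finset.mem_univ _),
    Finset.sum_eq_single_of_mem i (by simpa using hi)]
  · simp [ket]
  · intro j _ hj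
    have : (Pi.single s i : Fin n → Fin d) ≠ Pi.single s j := fun h =>
      hj (Pi.single_injective s h).symm
    simp [ket, this]
  · intro t _ hts
    refine Finset.sum_eq_zero fun j _ => ?_
    have : (Pi.single s i : Fin n → Fin d) ≠ Pi.single t j := fun h => by
      have := congrFun h s
      rw [Pi.single_eq_same, Pi.single_eq_of_ne hts.symm] at this
      exact hi this
    simp [ket, this]

theorem IsGWV.apply_eq_zero {n d : ℕ} [NeZero d] {ψ : QuditVec n d} (hψ : IsGWV ψ)
    (c : Fin n → Fin d) (s t : Fin n) (hst : s ≠ t) (hs : c s ≠ 0) (ht : c t ≠ 0) : ψ c = 0 := by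
  obtain ⟨p, a, -, -, -, rfl⟩ := hψ
  have h0 : c ≠ 0 := fun h => hs (congrFun h s)
  have hw : wVec a c = 0 := wVec_apply_eq_zero a fun u i _ h => by
    by_cases hsu : s = u
    · subst hsu
      rw [h, Pi.single_eq_of_ne hst.symm] at ht
      exact ht rfl
    · rw [h, Pi.single_eq_of_ne hsu] at hs
      exact hs rfl
  simp [hw, ket, h0]

theorem IsGWV.exists_vacuum_amplitude {n d : ℕ} [NeZero d] {ψ : QuditVec n d} (hψ : IsGWV ψ) :
    ∃ c : ℝ, ψ 0 = c ∧ c ^ 2 + excitationWeight ψ Finset.univ = 1 := by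
  obtain ⟨p, a, hp0, hp1, ha, rfl⟩ := hψ
  refine ⟨Real.sqrt (1 - p), ?_, ?_⟩
  · have : wVec a 0 = 0 := wVec_apply_eq_zero a fun s i hi h => by
      have := congrFun h s
      rw [Pi.single_eq_same] at this
      exact hi this.symm
    simp [this, ket]
  · rw [Real.sq_sqrt (by linarith), excitationWeight]
    have : ∀ s, ∀ i ∈ Finset.univ.filter (fun i : Fin d => i ≠ 0),
        ‖((Real.sqrt p : ℂ) • wVec a + (Real.sqrt (1 - p) : ℂ) • ket 0 : QuditVec n d)
          (Pi.single s i)‖ ^ 2 =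
          p * ‖a s i‖ ^ 2 := by
      intro s i hi
      have hi0 := (Finset.mem_filter.mp hi).2
      have hne : (Pi.single s i : Fin n → Fin d) ≠ 0 := fun h => hi0 (by
        have := congrFun h s
        rwa [Pi.single_eq_same] at this)
      simp only [Pi.add_apply, Pi.smul_apply, wVec_apply_single a s hi0, ket,
        Pi.single_eq_of_ne hne, mul_zero, add_zero, smul_eq_mul, norm_mul, mul_pow,
        Complex.norm_real, Real.norm_eq_abs, sq_abs, Real.sq_sqrt hp0]
    rw [Finset.sum_congr rfl fun s _ => Finset.sum_congr rfl (this s)]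
    simp only [← Finset.mul_sum, ha]
    ring

theorem glue_single_left {n d : ℕ} [NeZero d] (S : Finset (Fin n)) (s : {i // i ∈ S}) (i : Fin d) :
    glue S (Pi.single s i) 0 = Pi.single (s : Fin n) i := by
  ext t
  by_cases ht : t ∈ S <;> by_cases hts : t = s <;> simp_all [glue, Subtype.ext_iff]

theorem glue_single_right {n d : ℕ} [NeZero d] (S : Finset (Fin n)) (s : {i // i ∉ S})
    (i : Fin d) : glue S 0 (Pi.single s i) = Pi.single (s : Fin n) i := by
  have hs := s.2
  ext t
  by_cases ht : t ∈ S <;> by_cases hts : t = s <;> simp_all [glue, Subtype.ext_iff]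

/-- An excitation outside `S` leaves `S` in the vacuum, so tracing out the complement gives
`|ξ⟩⟨ξ| + μ |0⟩⟨0|`, with `ξ` the part of `ψ` that has the complement in the vacuum. -/
theorem IsGWV.reducedState_apply {n d : ℕ} [NeZero d] {ψ : QuditVec n d} (hψ : IsGWV ψ)
    (S : Finset (Fin n)) (u v : Config d S) :
    reducedState ψ S u v = ψ (glue S u 0) * star (ψ (glue S v 0)) +
      if u = 0 ∧ v = 0 then ((excitationWeight ψ Sᶜ : ℝ) : ℂ) else 0 := by
  have hz : ∀ (u : Config d S) (z : {i // i ∉ S} → Fin d), u ≠ 0 → z ≠ 0 →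
      ψ (glue S u z) = 0 := by
    intro u z hu hz
    obtain ⟨s, hs⟩ := Function.ne_iff.mp hu
    obtain ⟨t, ht⟩ := Function.ne_iff.mp hz
    refine hψ.apply_eq_zero _ s t (fun h => t.2 (h ▸ s.2)) ?_ ?_
    · simpa [glue] using hs
    · simpa [glue, t.2] using ht
  rw [reducedState, Matrix.of_apply, ← Finset.add_sum_erase _ _ (Finset.mem_univ 0)]
  congr 1
  split_ifs with h
  · rw [h.1, h.2, excitationWeight]
    have h1 := sum_ne_zero_eq_sum_single (fun z : {i // i ∉ S} → Fin d => ‖ψ (glue S 0 z)‖ ^ 2) (by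
      intro c s t hst hs ht
      rw [hψ.apply_eq_zero _ s t (fun h => hst (Subtype.ext h))]
      · simp
      · simpa [glue, s.2] using hs
      · simpa [glue, t.2] using ht)
    simp only [glue_single_right] at h1
    rw [Finset.sum_subtype Sᶜ (p := fun i => i ∉ S) (by simp), ← h1]
    push_cast
    simp only [Complex.star_def, Complex.mul_conj']
  · refine Finset.sum_eq_zero fun z hz' => ?_
    have hz' := Finset.ne_of_mem_erase hz'
    rcases not_and_or.mp h with h | h
    · rw [hz u z h hz', zero_mul]
    · rw [hz v z h hz', star_zero, mul_zero]

theorem glue_join_single_left {n d : ℕ} [NeZero d] (A B : Finset (Fin n)) (s : {i // i ∈ A})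
    (i : Fin d) : glue (A ∪ B) (join A B (Pi.single s i, 0)) 0 = Pi.single (s : Fin n) i := by
  ext t
  by_cases ht : t ∈ A <;> by_cases ht' : t ∈ B <;> by_cases hts : t = s <;>
    simp_all [glue, join, Subtype.ext_iff]

theorem glue_join_single_right {n d : ℕ} [NeZero d] {A B : Finset (Fin n)} (hAB : Disjoint A B)
    (s : {i // i ∈ B}) (i : Fin d) :
    glue (A ∪ B) (join A B (0, Pi.single s i)) 0 = Pi.single (s : Fin n) i := by
  have hs : (s : Fin n) ∉ A := fun h => Finset.disjoint_left.mp hAB h s.2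
  ext t
  by_cases ht : t ∈ A <;> by_cases ht' : t ∈ B <;> by_cases hts : t = s <;>
    simp_all [glue, join, Subtype.ext_iff]

theorem glue_join_apply_left {n d : ℕ} [NeZero d] {A B : Finset (Fin n)}
    (x : Config d A) (y : Config d B) (s : {i // i ∈ A}) :
    glue (A ∪ B) (join A B (x, y)) 0 s = x s := by
  simp [glue, join]

theorem glue_join_apply_right {n d : ℕ} [NeZero d] {A B : Finset (Fin n)} (hAB : Disjoint A B)
    (x : Config d A) (y : Config d B) (s : {i // i ∈ B}) :
    glue (A ∪ B) (join A B (x, y)) 0 s = y s := by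
  have hs : (s : Fin n) ∉ A := fun h => Finset.disjoint_left.mp hAB h s.2
  simp [glue, join, hs]

theorem join_eq_zero_iff {n d : ℕ} [NeZero d] {A B : Finset (Fin n)} (hAB : Disjoint A B)
    (u : Config d A × Config d B) : join A B u = 0 ↔ u = (0, 0) := by
  constructor
  · intro h
    have hg : glue (A ∪ B) (join A B (u.1, u.2)) (0 : {i // i ∉ A ∪ B} → Fin d) = 0 := by
      rw [Prod.mk.eta, h]
      ext t
      by_cases ht : t ∈ A ∪ B <;> simp [glue, ht]
    refine Prod.ext (funext fun s => ?_) (funext fun s => ?_)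
    · rw [← glue_join_apply_left u.1 u.2 s, hg]
      rfl
    · rw [← glue_join_apply_right hAB u.1 u.2 s, hg]
      rfl
  · rintro rfl
    ext t
    simp [join]

/-- The entanglement of `A` with `B` is that of a pure state with squared concurrence
`4 * excitationWeight ψ A * excitationWeight ψ B`, which is additive in `B`. -/
theorem IsGWV.TqE_bipartiteReduced {n d : ℕ} [NeZero d] {ψ : QuditVec n d} (hψ : IsGWV ψ)
    {q : ℝ} (hq0 : 0 < q) (hq : (q - 2) ^ 2 ≤ q + 1) {A B : Finset (Fin n)}
    (hAB : Disjoint A B) :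
    TqE q (bipartiteReduced ψ A B) =
      concurrenceEntropy q (2 * Real.sqrt (excitationWeight ψ A * excitationWeight ψ B)) := by
  obtain ⟨c, hc, hnorm⟩ := hψ.exists_vacuum_amplitude
  let ξ : Config d A × Config d B → ℂ := fun u => ψ (glue (A ∪ B) (join A B u) 0)
  have hξ : NoDoubleExcitation ξ := by
    intro x y hx hy
    obtain ⟨s, hs⟩ := Function.ne_iff.mp hx
    obtain ⟨t, ht⟩ := Function.ne_iff.mp hy
    refine hψ.apply_eq_zero _ s t (fun h => Finset.disjoint_left.mp hAB s.2 (h ▸ t.2)) ?_ ?_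
    · rwa [glue_join_apply_left]
    · rwa [glue_join_apply_right hAB]
  have hl : leftWeight ξ = excitationWeight ψ A := by
    rw [leftWeight, sum_ne_zero_eq_sum_single, excitationWeight, ← Finset.sum_coe_sort A]
    · simp only [ξ, glue_join_single_left]
    · intro x s t hst hs ht
      have : ξ (x, 0) = 0 := hψ.apply_eq_zero _ s t (fun h => hst (Subtype.ext h))
        (by rwa [glue_join_apply_left]) (by rwa [glue_join_apply_left])
      simp [this]
  have hr : rightWeight ξ = excitationWeight ψ B := by
    rw [rightWeight, sum_ne_zero_eq_sum_single, excitationWeight, ← Finset.sum_coe_sort B]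
    · simp only [ξ, glue_join_single_right hAB]
    · intro y s t hst hs ht
      have : ξ (0, y) = 0 := hψ.apply_eq_zero _ s t (fun h => hst (Subtype.ext h))
        (by rwa [glue_join_apply_right hAB]) (by rwa [glue_join_apply_right hAB])
      simp [this]
  rw [← hl, ← hr]
  refine TqE_eq_concurrenceEntropy hq0 hq (c := c) (μ := excitationWeight ψ (A ∪ B)ᶜ) hξ
    (excitationWeight_nonneg _ _) ?_ ?_ ?_
  · rw [← hc]
    have : glue (A ∪ B) (join A B ((0, 0) : Config d A × Config d B)) 0 = 0 := by
      rw [(join_eq_zero_iff hAB _).mpr rfl]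
      ext t
      by_cases ht : t ∈ A ∪ B <;> simp [glue, ht]
    simp only [ξ, this]
  · intro u v
    rw [bipartiteReduced, Matrix.submatrix_apply, hψ.reducedState_apply]
    simp only [join_eq_zero_iff hAB, ξ]
  · rw [hl, hr, ← hnorm, add_assoc, add_assoc]
    congr 1
    simp only [excitationWeight]
    rw [← add_assoc, ← Finset.sum_union hAB, Finset.sum_add_sum_compl]

theorem excitationWeight_biUnion {n d r : ℕ} [NeZero d] (ψ : QuditVec n d)
    {Q : Fin r → Finset (Fin n)} (hQQ : Pairwise fun i j => Disjoint (Q i) (Q j)) :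
    excitationWeight ψ (Finset.univ.biUnion Q) = ∑ j, excitationWeight ψ (Q j) :=
  Finset.sum_biUnion fun _ _ _ _ hij => hQQ hij

/-- The squared entanglement is monogamous: the squared concurrences add up, and the entanglement
is a convex function of the concurrence. -/
theorem IsGWV.sum_sq_TqE_le {n d r : ℕ} [NeZero d] {ψ : QuditVec n d} (hψ : IsGWV ψ)
    {q : ℝ} (hq0 : 0 < q) (hq : (q - 2) ^ 2 ≤ q + 1) {P : Finset (Fin n)}
    {Q : Fin r → Finset (Fin n)} (hPQ : ∀ j, Disjoint P (Q j))
    (hQQ : Pairwise fun i j => Disjoint (Q i) (Q j)) :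
    ∑ j, TqE q (bipartiteReduced ψ P (Q j)) ^ 2 ≤
      TqE q (bipartiteReduced ψ P (Finset.univ.biUnion Q)) ^ 2 := by
  have hd : Disjoint P (Finset.univ.biUnion Q) :=
    (Finset.disjoint_biUnion_right _ _ _).mpr fun j _ => hPQ j
  have hP := excitationWeight_nonneg ψ P
  have hw := fun j => excitationWeight_nonneg ψ (Q j)
  have hU := excitationWeight_nonneg ψ (Finset.univ.biUnion Q)
  simp only [hψ.TqE_bipartiteReduced hq0 hq (hPQ _), hψ.TqE_bipartiteReduced hq0 hq hd]
  refine sum_sq_le_sq_of_convexOn (convexOn_concurrenceEntropy hq0 hq)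
    (concurrenceEntropy_zero hq0) (concurrenceEntropy_nonneg hq0) _ _ _
    (fun j _ => by positivity) (by positivity) ?_ ?_
  · obtain ⟨c, -, hc⟩ := hψ.exists_vacuum_amplitude
    have hle : excitationWeight ψ P + excitationWeight ψ (Finset.univ.biUnion Q) ≤ 1 := by
      rw [excitationWeight, excitationWeight, ← Finset.sum_union hd]
      refine le_trans ?_ (by nlinarith [sq_nonneg c] : excitationWeight ψ Finset.univ ≤ 1)
      exact Finset.sum_le_sum_of_subset_of_nonneg (Finset.subset_univ _) fun s _ _ =>
        Finset.sum_nonneg fun i _ => by positivity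
    rw [Real.sqrt_mul hP]
    nlinarith [Real.sq_sqrt hP, Real.sq_sqrt hU,
      sq_nonneg (Real.sqrt (excitationWeight ψ P) -
        Real.sqrt (excitationWeight ψ (Finset.univ.biUnion Q)))]
  · simp only [mul_pow]
    rw [Real.sq_sqrt (by positivity), excitationWeight_biUnion ψ hQQ, Finset.mul_sum,
      Finset.mul_sum]
    exact Finset.sum_congr rfl fun j _ => by rw [Real.sq_sqrt (mul_nonneg hP (hw j))]

/-! ### The weighted monogamy inequalities -/

theorem theorem2 {n d : ℕ} [NeZero d] (ψ : QuditVec n d) (hψ : IsGWV ψ)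
    {r : ℕ} (P : Finset (Fin n)) (Q : Fin r → Finset (Fin n))
    (hP : P.Nonempty) (hQ : ∀ j, (Q j).Nonempty)
    (hPQ : ∀ j, Disjoint P (Q j)) (hQQ : Pairwise fun i j => Disjoint (Q i) (Q j))
    (q β k : ℝ)
    (hq : q ∈ Set.Icc ((5 - Real.sqrt 13) / 2) ((5 + Real.sqrt 13) / 2))
    (hβ : 2 ≤ β) (hk0 : 0 < k) (hk1 : k ≤ 1)
    (hcond : ∀ l : Fin r, (l : ℕ) + 2 ≤ r →
      k * TqE q (bipartiteReduced ψ P (Q l)) ^ 2 ≥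
        ∑ j ∈ Finset.Ioi l, TqE q (bipartiteReduced ψ P (Q j)) ^ 2) :
    TqE q (bipartiteReduced ψ P (Finset.univ.biUnion Q)) ^ β ≥
        ∑ j : Fin r, Kfactor k β ^ (j : ℕ) * TqE q (bipartiteReduced ψ P (Q j)) ^ β ∧
      ∑ j : Fin r, Kfactor k β ^ (j : ℕ) * TqE q (bipartiteReduced ψ P (Q j)) ^ β ≥
        ∑ j : Fin r, Kfactor k β ^ hammingWeight j *
          TqE q (bipartiteReduced ψ P (Q j)) ^ β := by
  have h13 : Real.sqrt 13 ^ 2 = 13 := Real.sq_sqrt (by norm_num)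
  have h13' : Real.sqrt 13 < 5 := by
    rw [Real.sqrt_lt' (by norm_num)]
    norm_num
  obtain ⟨hql, hqu⟩ := hq
  have hq0 : 0 < q := by linarith
  -- the endpoints are the roots of `q² - 5 q + 3`
  have hq2 : (q - 2) ^ 2 ≤ q + 1 := by
    nlinarith [mul_nonneg (sub_nonneg.mpr hql) (sub_nonneg.mpr hqu)]
  have hd : Disjoint P (Finset.univ.biUnion Q) :=
    (Finset.disjoint_biUnion_right _ _ _).mpr fun j _ => hPQ j
  have hnn : ∀ j, 0 ≤ TqE q (bipartiteReduced ψ P (Q j)) := fun j => by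
    rw [hψ.TqE_bipartiteReduced hq0 hq2 (hPQ j)]
    exact concurrenceEntropy_nonneg hq0 _
  have hnnU : 0 ≤ TqE q (bipartiteReduced ψ P (Finset.univ.biUnion Q)) := by
    rw [hψ.TqE_bipartiteReduced hq0 hq2 hd]
    exact concurrenceEntropy_nonneg hq0 _
  have hpow : ∀ x : ℝ, 0 ≤ x → (x ^ 2) ^ (β / 2) = x ^ β := by
    intro x hx
    rw [← Real.rpow_natCast, ← Real.rpow_mul hx]
    congr 1
    push_cast
    ring
  have hK := one_le_Kfactor hβ hk0
  constructor
  · have h1 := sum_Kfactor_pow_mul_rpow_le hk0 hβ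
      (fun j => TqE q (bipartiteReduced ψ P (Q j)) ^ 2) (fun j => sq_nonneg _) (fun l => by
        by_cases hl : (l : ℕ) + 2 ≤ r
        · exact hcond l hl
        · have : Finset.Ioi l = ∅ := by
            ext j
            have := j.2
            simp only [Finset.mem_Ioi, Finset.notMem_empty, iff_false, Fin.lt_def]
            omega
          rw [this, Finset.sum_empty]
          positivity)
    simp only [hpow _ (hnn _)] at h1
    refine h1.trans ?_
    rw [← hpow _ hnnU]
    exact Real.rpow_le_rpow (Finset.sum_nonneg fun j _ => sq_nonneg _)
      (hψ.sum_sq_TqE_le hq0 hq2 hPQ hQQ) (by linarith)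
  · exact Finset.sum_le_sum fun j _ => mul_le_mul_of_nonneg_right
      (pow_le_pow_right₀ hK (hammingWeight_le j)) (Real.rpow_nonneg (hnn j) _)
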